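/- Let $p$ be a prime and fix $\pi$ in an algebraic closure $\overline{\mathbb{Q}}_p$ of $\mathbb{Q}_p$ with $\pi^{p-1}=-p$. Let $c_j$ ($j\ge 0$) be the coefficients of the power series \[ E_\pi(t)=\exp\bigl(\pi(t-t^p)\bigr)=\sum_{j\ge 0}c_jt^j , \] and put $c_j=0$ for $j<0$. Let $(b)_i=b(b+1)\cdots(b+i-1)$ for $i\ge 0$ and $(b)_{-n}=1/\bigl((b-1)(b-2)\cdots(b-n)\bigr)$ for $n\geq 1$. For $a,b\in\mathbb{Z}_{(p)}$ with $pb-a=\mu\in\mathbb{Z}$, Dwork's symbol is \[ \gamma_p(a,b)=\sum_{i\in\mathbb{Z}}c_{pi+\mu}\,\frac{(b)_i}{(-\pi)^i}, \] where terms with $c_{pi+\mu}=0$ are read as $0$. Let $\Gamma_p:\mathbb{Z}_p\to\mathbb{Z}_p^\times$ be Morita's $p$-adic gamma function, that is, the unique continuous function with $\Gamma_p(0)=1$ and with $\Gamma_p(x+1)/\Gamma_p(x)$ equal to $-x$ if $x\notin p\mathbb{Z}_p$ and to $-1$ if $x\in p\mathbb{Z}_p$. Theorem (Dwork). If $a,b\in\mathbb{Z}_{(p)}$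 and $pb-a=\mu\in\{0,\dots,p-1\}$, then the series defining $\gamma_p(a,b)$ converges ($p$-adically, in $\overline{\mathbb{Q}}_p$) and \[ \gamma_p(a,b)=\pi^\mu\,\Gamma_p(a). \] -/

import Mathlib

namespace DworkGamma

/-! ### Morita's `p`-adic gamma function -/

/-- The characterization of Morita's `p`-adic gamma function: a continuous function
`Γ : ℤ_p → ℤ_pˣ` with `Γ 0 = 1` and `Γ (x + 1) / Γ x` equal to `-x` if `x ∉ p ℤ_p` and to `-1`
if `x ∈ p ℤ_p`. -/
structure IsMoritaGamma (p : ℕ) [Fact p.Prime] (Γ : ℤ_[p] → ℤ_[p]ˣ) : Prop where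
  continuous : Continuous Γ
  map_zero : Γ 0 = 1
  map_add_one_of_not_dvd : ∀ x : ℤ_[p], ¬ (p : ℤ_[p]) ∣ x →
    ((Γ (x + 1) / Γ x : ℤ_[p]ˣ) : ℤ_[p]) = -x
  map_add_one_of_dvd : ∀ x : ℤ_[p], (p : ℤ_[p]) ∣ x →
    ((Γ (x + 1) / Γ x : ℤ_[p]ˣ) : ℤ_[p]) = -1

/-- The step factor on natural numbers. -/
def stepFactor (p : ℕ) (n : ℕ) : ℤ := if p ∣ n then -1 else -(n : ℤ)

/-- The values of the gamma function at natural numbers. -/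
def natGamma (p : ℕ) (n : ℕ) : ℤ := ∏ j ∈ Finset.range n, stepFactor p j

theorem natGamma_succ (p n : ℕ) : natGamma p (n + 1) = natGamma p n * stepFactor p n := by
  simp [natGamma, Finset.prod_range_succ]

theorem stepFactor_modEq (p k m n : ℕ) (h : m ≡ n [MOD p ^ (k + 1)]) :
    stepFactor p m ≡ stepFactor p n [ZMOD (p ^ (k + 1) : ℕ)] := by
  have h1 : p ∣ m ↔ p ∣ n := (h.of_dvd (dvd_pow_self p k.succ_ne_zero)).dvd_iff dvd_rfl
  unfold stepFactor
  by_cases hn : p ∣ n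
  · simp [hn, h1.2 hn]
  · simp only [hn, h1, if_false]
    exact ((Int.natCast_modEq_iff).2 h).neg

theorem natGamma_add (p k n : ℕ) :
    natGamma p (n + p ^ (k + 1)) ≡ natGamma p (p ^ (k + 1)) * natGamma p n
      [ZMOD (p ^ (k + 1) : ℕ)] := by
  induction n with
  | zero => simp [natGamma]
  | succ n ih =>
    have e : n + 1 + p ^ (k + 1) = (n + p ^ (k + 1)) + 1 := by ring
    rw [e, natGamma_succ, natGamma_succ, ← mul_assoc]
    exact ih.mul (stepFactor_modEq p k _ _ (by simp [Nat.ModEq]))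

theorem natGamma_mul (p k m : ℕ) :
    natGamma p (m * p ^ (k + 1)) ≡ natGamma p (p ^ (k + 1)) ^ m [ZMOD (p ^ (k + 1) : ℕ)] := by
  induction m with
  | zero => simp [natGamma]
  | succ m ih =>
    rw [add_mul, one_mul, pow_succ' (natGamma p (p ^ (k + 1))) m]
    exact (natGamma_add p k _).trans (ih.mul_left _)

theorem natGamma_prime (p : ℕ) [hp : Fact p.Prime] : natGamma p p ≡ 1 [ZMOD p] := by
  obtain ⟨q, rfl⟩ : ∃ q, p = q + 1 := ⟨p - 1, (Nat.succ_pred_prime hp.out).symm⟩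
  have h1 : ∀ j ∈ Finset.range q, stepFactor (q + 1) (j + 1) = -1 * ((j + 1 : ℕ) : ℤ) := by
    intro j hj
    have : ¬ (q + 1) ∣ (j + 1) := fun h => by
      have := Nat.le_of_dvd (Nat.succ_pos _) h
      have := Finset.mem_range.1 hj
      omega
    rw [stepFactor, if_neg this, neg_one_mul]
  have h2 : natGamma (q + 1) (q + 1) = (-1) ^ (q + 1) * (q.factorial : ℤ) := by
    rw [natGamma, Finset.prod_range_succ', Finset.prod_congr rfl h1, Finset.prod_mul_distrib,
      ← Finset.prod_range_add_one_eq_factorial]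
    push_cast
    simp [stepFactor, pow_succ]
  rw [← ZMod.intCast_eq_intCast_iff, h2]
  have hw := ZMod.wilsons_lemma (q + 1)
  have hf : ((-1 : ZMod (q + 1)) ^ (q + 1)) = -1 := ZMod.pow_card _
  simp only [Nat.add_sub_cancel] at hw
  push_cast
  push_cast at hw hf
  rw [hw, hf]
  ring

theorem natGamma_prime_pow (p : ℕ) [hp : Fact p.Prime] (k : ℕ) :
    natGamma p (p ^ (k + 2)) ≡ 1 [ZMOD (p ^ (k + 1) : ℕ)] := by
  induction k with
  | zero =>
    have h := natGamma_mul p 0 p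
    have e : p * p ^ (0 + 1) = p ^ (0 + 2) := by ring
    rw [e] at h
    refine h.trans ?_
    simpa using (natGamma_prime p).pow p
  | succ k ih =>
    have h := natGamma_mul p (k + 1) p
    have e : p * p ^ (k + 1 + 1) = p ^ (k + 1 + 2) := by ring
    rw [e] at h
    refine h.trans ?_
    set x := natGamma p (p ^ (k + 1 + 1)) with hx
    have hxk : ((p ^ (k + 1) : ℕ) : ℤ) ∣ x - 1 := (Int.modEq_iff_dvd.1 ih.symm)
    have hxp : x ≡ 1 [ZMOD p] :=
      Int.ModEq.of_dvd (by exact_mod_cast dvd_pow_self p k.succ_ne_zero) ih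
    have hs : (p : ℤ) ∣ ∑ i ∈ Finset.range p, x ^ i := by
      have : (∑ i ∈ Finset.range p, x ^ i) ≡ ∑ i ∈ Finset.range p, 1 [ZMOD p] :=
        Int.ModEq.sum fun i _ => by simpa using hxp.pow i
      refine (Int.modEq_zero_iff_dvd).1 (this.trans ?_)
      simp [Int.ModEq]
    refine (Int.modEq_iff_dvd.2 ?_).symm
    rw [← mul_geom_sum, pow_succ p (k + 1), Nat.cast_mul]
    exact mul_dvd_mul hxk hs

theorem natGamma_modEq (p : ℕ) [hp : Fact p.Prime] (k : ℕ) {m n : ℕ}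
    (h : m ≡ n [MOD p ^ (k + 2)]) : natGamma p m ≡ natGamma p n [ZMOD (p ^ (k + 1) : ℕ)] := by
  have hpk : ((p ^ (k + 1) : ℕ) : ℤ) ∣ ((p ^ (k + 1 + 1) : ℕ) : ℤ) :=
    Int.natCast_dvd_natCast.2 (pow_dvd_pow p (Nat.le_succ _))
  have key : ∀ n t : ℕ, natGamma p (n + t * p ^ (k + 2)) ≡ natGamma p n
      [ZMOD (p ^ (k + 1) : ℕ)] := by
    intro n t
    induction t with
    | zero => simp
    | succ t ih =>
      have e : n + (t + 1) * p ^ (k + 2) = (n + t * p ^ (k + 2)) + p ^ (k + 1 + 1) := by ring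
      rw [e]
      have h1 := Int.ModEq.of_dvd hpk (natGamma_add p (k + 1) (n + t * p ^ (k + 2)))
      refine h1.trans ?_
      simpa using (natGamma_prime_pow p k).mul ih
  rcases le_total m n with hmn | hmn
  · obtain ⟨c, hc⟩ := (Nat.modEq_iff_dvd' hmn).1 h
    have : n = m + c * p ^ (k + 2) := by rw [mul_comm]; omega
    rw [this]
    exact (key m c).symm
  · obtain ⟨c, hc⟩ := (Nat.modEq_iff_dvd' hmn).1 h.symm
    have : m = n + c * p ^ (k + 2) := by rw [mul_comm]; omega
    rw [this]
    exact key n c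

theorem natGamma_uniform (p : ℕ) [hp : Fact p.Prime] (ε : ℝ) (hε : 0 < ε) :
    ∃ δ > 0, ∀ m n : ℕ, dist (m : ℤ_[p]) n < δ →
      dist (natGamma p m : ℤ_[p]) (natGamma p n) < ε := by
  obtain ⟨k, hk⟩ := PadicInt.exists_pow_neg_lt p hε
  refine ⟨(p : ℝ) ^ (-((k + 2 : ℕ) : ℤ)), zpow_pos (by exact_mod_cast hp.out.pos) _, ?_⟩
  intro m n hmn
  rw [dist_eq_norm] at hmn ⊢
  have h1 : ((p ^ (k + 2) : ℕ) : ℤ) ∣ (m : ℤ) - n := by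
    have := (PadicInt.norm_int_le_pow_iff_dvd (p := p) (k := (m : ℤ) - n) (n := k + 2)).1
      (by push_cast at hmn ⊢; exact hmn.le)
    exact_mod_cast this
  have h2 : m ≡ n [MOD p ^ (k + 2)] := (Nat.modEq_iff_dvd.2 h1).symm
  have h3 := (Int.modEq_iff_dvd.1 (natGamma_modEq p k h2).symm)
  have h4 : ((p : ℤ) ^ k) ∣ natGamma p m - natGamma p n :=
    dvd_trans (by push_cast; exact pow_dvd_pow _ (by omega)) h3
  have h5 := (PadicInt.norm_int_le_pow_iff_dvd (p := p)).2 h4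
  push_cast at h5
  exact lt_of_le_of_lt h5 hk

theorem isClosed_setOf_dvd (p : ℕ) [hp : Fact p.Prime] :
    IsClopen {x : ℤ_[p] | (p : ℤ_[p]) ∣ x} := by
  have : {x : ℤ_[p] | (p : ℤ_[p]) ∣ x} = Metric.ball 0 1 := by
    ext x
    simp [← PadicInt.norm_lt_one_iff_dvd]
  rw [this]
  exact IsUltrametricDist.isClopen_ball 0 1

theorem IsMoritaGamma.eq_natGamma {p : ℕ} [hp : Fact p.Prime] {Γ : ℤ_[p] → ℤ_[p]ˣ}
    (h : IsMoritaGamma p Γ) (n : ℕ) : (Γ n : ℤ_[p]) = natGamma p n := by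
  induction n with
  | zero => simp [natGamma, h.map_zero]
  | succ n ih =>
    have e : (Γ ((n : ℤ_[p]) + 1) : ℤ_[p]) =
        Γ n * ((Γ ((n : ℤ_[p]) + 1) / Γ n : ℤ_[p]ˣ) : ℤ_[p]) := by
      rw [← Units.val_mul, mul_div_cancel]
    have hd : (p : ℤ_[p]) ∣ (n : ℤ_[p]) ↔ p ∣ n := by
      have := PadicInt.pow_p_dvd_int_iff (p := p) 1 (n : ℤ)
      simpa [Int.natCast_dvd_natCast] using this
    rw [Nat.cast_succ, e, natGamma_succ, ih, stepFactor]
    by_cases hn : p ∣ n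
    · rw [h.map_add_one_of_dvd _ (hd.2 hn), if_pos hn]
      push_cast
      ring
    · rw [h.map_add_one_of_not_dvd _ (fun h' => hn (hd.1 h')), if_neg hn]
      push_cast
      ring

/-- Existence and uniqueness of Morita's `p`-adic gamma function. -/
theorem existsUnique_isMoritaGamma (p : ℕ) [hp : Fact p.Prime] :
    ∃! Γ : ℤ_[p] → ℤ_[p]ˣ, IsMoritaGamma p Γ := by
  classical
  have hdense : Dense (Set.range (Nat.cast : ℕ → ℤ_[p])) := PadicInt.denseRange_natCast
  have hd : ∀ n : ℕ, (p : ℤ_[p]) ∣ (n : ℤ_[p]) ↔ p ∣ n := by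
    intro n
    have := PadicInt.pow_p_dvd_int_iff (p := p) 1 (n : ℤ)
    simpa [Int.natCast_dvd_natCast] using this
  set A : Set ℤ_[p] := Set.range (Nat.cast : ℕ → ℤ_[p]) with hA
  set f : ℤ_[p] → ℤ_[p] := fun x => (natGamma p (Function.invFun Nat.cast x) : ℤ_[p]) with hf
  have hfn : ∀ n : ℕ, f n = natGamma p n := fun n => by
    simp only [hf, Function.leftInverse_invFun (Nat.cast_injective (R := ℤ_[p])) n]
  have hu : UniformContinuousOn f A := by
    rw [Metric.uniformContinuousOn_iff]
    intro ε hε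
    obtain ⟨δ, hδ, h⟩ := natGamma_uniform p ε hε
    refine ⟨δ, hδ, ?_⟩
    rintro _ ⟨m, rfl⟩ _ ⟨n, rfl⟩ hmn
    rw [hfn, hfn]
    exact h m n hmn
  have hlim : ∀ x, ∃ y, Filter.Tendsto f (nhdsWithin x A) (nhds y) := by
    intro x
    have : (nhdsWithin x A).NeBot := mem_closure_iff_nhdsWithin_neBot.1 (hdense x)
    have hc : Cauchy (Filter.map f (nhdsWithin x A)) := by
      rw [Metric.cauchy_iff]
      refine ⟨inferInstance, fun ε hε => ?_⟩
      obtain ⟨δ, hδ, h⟩ := Metric.uniformContinuousOn_iff.1 hu ε hε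
      refine ⟨f '' (Metric.ball x (δ / 2) ∩ A), Filter.image_mem_map ?_, ?_⟩
      · exact Filter.inter_mem (mem_nhdsWithin_of_mem_nhds (Metric.ball_mem_nhds x (half_pos hδ)))
          self_mem_nhdsWithin
      · rintro _ ⟨y, ⟨hy, hyA⟩, rfl⟩ _ ⟨z, ⟨hz, hzA⟩, rfl⟩
        refine h y hyA z hzA ?_
        have := dist_triangle_right y z x
        rw [Metric.mem_ball] at hy hz
        linarith
    exact CompleteSpace.complete hc
  set G : ℤ_[p] → ℤ_[p] := extendFrom A f with hG
  have hGc : Continuous G := continuous_extendFrom hdense hlim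
  have hGn : ∀ n : ℕ, G n = natGamma p n := fun n => by
    rw [← hfn]
    exact extendFrom_eq (hdense _) (hu.continuousOn _ ⟨n, rfl⟩)
  set s : ℤ_[p] → ℤ_[p] := fun x => if (p : ℤ_[p]) ∣ x then -1 else -x with hs
  have hsc : Continuous s := by
    refine Continuous.if ?_ continuous_const continuous_neg
    intro a ha
    rw [(isClosed_setOf_dvd p).frontier_eq] at ha
    exact ha.elim
  have hsn : ∀ n : ℕ, s n = stepFactor p n := fun n => by
    simp only [hs, hd, stepFactor]
    split_ifs <;> simp
  have hGs : ∀ x, G (x + 1) = G x * s x := by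
    have := (PadicInt.denseRange_natCast (p := p)).equalizer
      (hGc.comp (continuous_id.add (continuous_const (y := (1 : ℤ_[p]))))) (hGc.mul hsc) (by
        funext n
        have := hGn (n + 1)
        push_cast at this
        simp [this, hGn, hsn, natGamma_succ])
    exact fun x => congrFun this x
  have hsnorm : ∀ x, ‖s x‖ = 1 := by
    intro x
    simp only [hs]
    split_ifs with h
    · simp
    · rw [norm_neg]
      exact le_antisymm (PadicInt.norm_le_one x)
        (not_lt.1 fun h' => h ((PadicInt.norm_lt_one_iff_dvd x).1 h'))
  have hG0 : G 0 = 1 := by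
    have := hGn 0
    simpa [natGamma] using this
  have hGnorm : ∀ x, ‖G x‖ = 1 := by
    have := (PadicInt.denseRange_natCast (p := p)).equalizer
      hGc.norm (continuous_const (y := (1 : ℝ))) (by
        funext n
        simp only [Function.comp]
        induction n with
        | zero => simp [hG0]
        | succ n ih => rw [Nat.cast_succ, hGs, norm_mul, ih, hsnorm, mul_one])
    exact fun x => congrFun this x
  have hGu : ∀ x, IsUnit (G x) := fun x => PadicInt.isUnit_iff.2 (hGnorm x)
  have hdiv : ∀ x, (((hGu (x + 1)).unit / (hGu x).unit : ℤ_[p]ˣ) : ℤ_[p]) = s x := by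
    intro x
    rw [← (hGu x).mul_right_inj]
    have : (hGu x).unit * ((hGu (x + 1)).unit / (hGu x).unit) = (hGu (x + 1)).unit :=
      mul_div_cancel _ _
    have := congrArg (Units.val) this
    rw [Units.val_mul] at this
    simpa [hGs] using this
  refine ⟨fun x => (hGu x).unit, ⟨?_, ?_, ?_, ?_⟩, ?_⟩
  · rw [Units.isOpenEmbedding_val.isEmbedding.continuous_iff]
    exact hGc
  · ext
    simp [hG0]
  · intro x hx
    rw [hdiv]
    simp [hs, hx]
  · intro x hx
    rw [hdiv]
    simp [hs, hx]
  · intro Γ hΓ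
    have := (PadicInt.denseRange_natCast (p := p)).equalizer
      (Units.continuous_val.comp hΓ.continuous) hGc (by
        funext n
        simp [hΓ.eq_natGamma, hGn])
    funext x
    ext1
    exact congrFun this x

/-- Morita's `p`-adic gamma function `Γ_p : ℤ_p → ℤ_pˣ`. -/
noncomputable def moritaGamma (p : ℕ) [Fact p.Prime] : ℤ_[p] → ℤ_[p]ˣ :=
  (existsUnique_isMoritaGamma p).choose

theorem isMoritaGamma_moritaGamma (p : ℕ) [Fact p.Prime] : IsMoritaGamma p (moritaGamma p) :=
  (existsUnique_isMoritaGamma p).choose_spec.1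

/-! ### The Dwork exponential series and Dwork's symbol -/

/-- The Dwork exponential series `E_π(t) = exp (π (t - t ^ p))`, as a formal power series over
the algebraic closure `PadicAlgCl p` of `ℚ_p`. -/
noncomputable def dworkExp (p : ℕ) [Fact p.Prime] (π : PadicAlgCl p) :
    PowerSeries (PadicAlgCl p) :=
  (PowerSeries.exp (PadicAlgCl p)).subst
    (PowerSeries.C π * (PowerSeries.X - PowerSeries.X ^ p))

/-- The substitution in `dworkExp` is a legitimate one: the inner series has no constant term. -/
theorem hasSubst_dworkExp (p : ℕ) [hp : Fact p.Prime] (π : PadicAlgCl p) :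
    PowerSeries.HasSubst (PowerSeries.C π * (PowerSeries.X - PowerSeries.X ^ p) :
      PowerSeries (PadicAlgCl p)) := by
  apply PowerSeries.HasSubst.of_constantCoeff_zero'
  simp [hp.out.ne_zero]

/-- The coefficient `c_n` of `t ^ n` in `E_π(t)` for `n ∈ ℤ`; it vanishes for `n < 0`. -/
noncomputable def dworkCoeff (p : ℕ) [Fact p.Prime] (π : PadicAlgCl p) (n : ℤ) : PadicAlgCl p :=
  if 0 ≤ n then PowerSeries.coeff n.toNat (dworkExp p π) else 0

/-- The Pochhammer symbol `(x)_i` for `i ∈ ℤ`: it is `x (x + 1) ⋯ (x + i - 1)` for `i ≥ 0` and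
`1 / ((x - 1) (x - 2) ⋯ (x - n))` for `i = -n < 0`. -/
noncomputable def pochhammer {K : Type*} [Field K] (x : K) : ℤ → K
  | Int.ofNat n => ∏ j ∈ Finset.range n, (x + j)
  | Int.negSucc n => (∏ j ∈ Finset.range (n + 1), (x - (j + 1)))⁻¹

/-- The `i`-th term `c_{p i + μ} (b)_i / (-π) ^ i` of the series that defines Dwork's symbol. -/
noncomputable def dworkTerm (p : ℕ) [Fact p.Prime] (π : PadicAlgCl p) (μ : ℤ) (b : ℚ) (i : ℤ) :
    PadicAlgCl p :=
  dworkCoeff p π (p * i + μ) * pochhammer (b : PadicAlgCl p) i / (-π) ^ i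

/-- Dwork's symbol `γ_p(a, b) = ∑_{i ∈ ℤ} c_{p i + μ} (b)_i / (-π) ^ i`, where `μ = p b - a`
(for rational numbers `a`, `b` such that `p b - a` is an integer). -/
noncomputable def dworkGamma (p : ℕ) [Fact p.Prime] (π : PadicAlgCl p) (a b : ℚ) : PadicAlgCl p :=
  ∑' i : ℤ, dworkTerm p π ⌊(p : ℚ) * b - a⌋ b i

end DworkGamma

namespace DworkGamma

open PowerSeries Finset

/-! ### Exponentials of power series -/

section ExpSubst

variable {A : Type*} [CommRing A] [Algebra ℚ A]

/-! Dwork's series is the Mahler expansion of `g(x) = Γ_p(-(p x + μ))`, evaluated at `x = -b`, where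
the argument of `Γ_p` is `p b - μ = a`. Since `binom(-b, i) = (-1)^i (b)_i / i!`, it suffices that
`π^μ Δ^i g(0) = c_{pi+μ} i! / π^i` (`pow_mul_fwdDiff_negGamma`). By binomial inversion this need
only be checked after summing against `binom(m, i)`. The left side becomes `π^μ g(m)`, and the
functional equation gives `g(m) = (-p)^m m! / (pm+μ)!`. The right side is the coefficient of
`t^{pm+μ}` in `E_π(t) exp(π t^p) = exp(π t)`, times `m! / π^m` (`sum_coeff_dworkExp`). They agree
because `π^{p-1} = -p`. Convergence comes from Mahler's theorem for the continuous function `g`; no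
estimate of the `c_j` is needed. -/

theorem constantCoeff_exp_subst {f : A⟦X⟧} (hf : constantCoeff f = 0) :
    constantCoeff ((exp A).subst f) = 1 := by
  have hs := HasSubst.of_constantCoeff_zero' hf
  have h : exp A = C 1 + (exp A - C 1) := by ring
  have h0 := constantCoeff_subst_eq_zero (S := A) (a := f) hf (exp A - C 1) (by simp)
  rw [h, subst_add hs, subst_C, map_add]
  have h1 : constantCoeff (MvPowerSeries.C 1 : A⟦X⟧) = 1 := constantCoeff_C 1
  rw [h1]
  exact (congrArg (1 + ·) h0).trans (add_zero 1)

theorem derivative_exp_subst {f : A⟦X⟧} (hf : constantCoeff f = 0) :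
    derivative A ((exp A).subst f) = (exp A).subst f * derivative A f := by
  rw [derivative_subst (HasSubst.of_constantCoeff_zero' hf), derivative_exp]

variable [IsAddTorsionFree A]

theorem exp_subst_mul_exp_subst_neg {f : A⟦X⟧} (hf : constantCoeff f = 0) :
    (exp A).subst f * (exp A).subst (-f) = 1 := by
  have hf' : constantCoeff (-f) = 0 := by simp [hf]
  apply derivative.ext
  · rw [Derivation.leibniz, derivative_exp_subst hf, derivative_exp_subst hf', map_neg]
    simp only [smul_eq_mul, Derivation.map_one_eq_zero]
    ring
  · rw [map_mul, constantCoeff_exp_subst hf, constantCoeff_exp_subst hf']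
    simp

/-- Multiplying by the exponential of `-(f + g)` gives a product with zero derivative and constant
term 1, hence equal to 1; the inverse found above then cancels the extra factor. -/
theorem exp_subst_mul_exp_subst {f g : A⟦X⟧} (hf : constantCoeff f = 0)
    (hg : constantCoeff g = 0) :
    (exp A).subst f * (exp A).subst g = (exp A).subst (f + g) := by
  have hfg : constantCoeff (f + g) = 0 := by simp [hf, hg]
  have hfg' : constantCoeff (-(f + g)) = 0 := by simp [hf, hg]
  have h : (exp A).subst f * (exp A).subst g * (exp A).subst (-(f + g)) = 1 := by
    apply derivative.ext
    · rw [Derivation.leibniz, Derivation.leibniz, derivative_exp_subst hf,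
        derivative_exp_subst hg, derivative_exp_subst hfg', map_neg, map_add]
      simp only [smul_eq_mul, Derivation.map_one_eq_zero]
      ring
    · rw [map_mul, map_mul, constantCoeff_exp_subst hf, constantCoeff_exp_subst hg,
        constantCoeff_exp_subst hfg']
      simp
  calc _ = (exp A).subst f * (exp A).subst g *
        ((exp A).subst (f + g) * (exp A).subst (-(f + g))) := by
        rw [exp_subst_mul_exp_subst_neg hfg, mul_one]
    _ = (exp A).subst f * (exp A).subst g * (exp A).subst (-(f + g)) *
        (exp A).subst (f + g) := by ring
    _ = _ := by rw [h, one_mul]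

end ExpSubst

theorem coeff_exp_subst_C_mul_X {K : Type*} [Field K] [Algebra ℚ K] (c : K) (n : ℕ) :
    coeff n ((exp K).subst (C c * X : K⟦X⟧)) = c ^ n / n.factorial := by
  rw [← smul_eq_C_mul, ← rescale_eq_subst, coeff_rescale, coeff_exp]
  simp [div_eq_mul_inv]

theorem coeff_exp_subst_C_mul_X_pow {K : Type*} [Field K] [Algebra ℚ K] (c : K) {p : ℕ}
    (hp : p ≠ 0) (n : ℕ) :
    coeff n ((exp K).subst (C c * X ^ p : K⟦X⟧)) =
      if p ∣ n then c ^ (n / p) / (n / p).factorial else 0 := by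
  have h : (C c * X ^ p : K⟦X⟧) = (C c * X : K⟦X⟧).subst (X ^ p : K⟦X⟧) := by
    rw [← smul_eq_C_mul, ← smul_eq_C_mul, subst_smul (HasSubst.X_pow hp),
      subst_X (HasSubst.X_pow hp)]
  rw [h, ← subst_comp_subst_apply (HasSubst.of_constantCoeff_zero' (by simp))
    (HasSubst.X_pow hp), coeff_subst_X_pow hp, coeff_exp_subst_C_mul_X]
  rfl

/-! ### The coefficients of the Dwork exponential series -/

variable {p : ℕ} [hp : Fact p.Prime]

theorem dworkExp_mul_exp_subst (π : PadicAlgCl p) :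
    dworkExp p π * (exp (PadicAlgCl p)).subst (C π * X ^ p : (PadicAlgCl p)⟦X⟧) =
      (exp (PadicAlgCl p)).subst (C π * X : (PadicAlgCl p)⟦X⟧) := by
  rw [dworkExp, exp_subst_mul_exp_subst (by simp [hp.out.ne_zero]) (by simp [hp.out.ne_zero])]
  congr 1
  ring

/-- The series `exp(π t^p)` lives in degrees divisible by `p`, so only the `c_j` with `j ≡ μ` mod
`p` contribute in degree `pm + μ`. -/
theorem sum_coeff_dworkExp (π : PadicAlgCl p) (m : ℕ) {μ : ℕ} (hμ : μ < p) :
    ∑ i ∈ range (m + 1), coeff (p * i + μ) (dworkExp p π) * (π ^ (m - i) / (m - i).factorial) =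
      π ^ (p * m + μ) / (p * m + μ).factorial := by
  have h := congrArg (coeff (p * m + μ)) (dworkExp_mul_exp_subst π)
  have hp0 : 0 < p := hp.out.pos
  rw [coeff_exp_subst_C_mul_X, coeff_mul] at h
  rw [← h]
  refine Finset.sum_of_injOn (fun i => (p * i + μ, p * (m - i))) ?_ ?_ ?_ ?_
  · intro i _ j _ hij
    exact Nat.eq_of_mul_eq_mul_left hp0 (Nat.add_right_cancel (congrArg Prod.fst hij))
  · intro i hi
    have hi' : i ≤ m := Nat.lt_succ_iff.1 (Finset.mem_range.1 hi)
    have : p * i + p * (m - i) = p * m := by rw [← mul_add, Nat.add_sub_cancel' hi']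
    rw [mem_coe, HasAntidiagonal.mem_antidiagonal]
    simp only
    omega
  · rintro ⟨j, k⟩ hjk hne
    rw [HasAntidiagonal.mem_antidiagonal] at hjk
    rw [coeff_exp_subst_C_mul_X_pow _ hp0.ne', if_neg, mul_zero]
    rintro ⟨l, rfl⟩
    simp only at hjk
    -- Here `μ < p` is needed: `p l ≤ p m + μ` must force `l ≤ m`.
    have hl : l ≤ m := by
      by_contra! hl
      have := Nat.mul_le_mul_left p hl
      rw [Nat.mul_succ] at this
      omega
    refine hne ⟨m - l, by simp, ?_⟩
    have : p * (m - l) + p * l = p * m := by rw [← mul_add, Nat.sub_add_cancel hl]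
    ext <;> simp only
    · omega
    · rw [Nat.sub_sub_self hl]
  · intro i _
    rw [coeff_exp_subst_C_mul_X_pow _ hp0.ne', if_pos (dvd_mul_right _ _),
      Nat.mul_div_cancel_left _ hp0]

theorem dworkCoeff_natCast (π : PadicAlgCl p) (n : ℕ) :
    dworkCoeff p π n = coeff n (dworkExp p π) := by
  simp [dworkCoeff]

/-- As `μ < p`, the index `p i + μ` is negative for `i < 0`, so the bilateral series is one-sided.
-/
theorem dworkTerm_negSucc (π : PadicAlgCl p) {μ : ℕ} (hμ : μ < p) (b : ℚ) (n : ℕ) :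
    dworkTerm p π μ b (Int.negSucc n) = 0 := by
  have h : ¬ 0 ≤ (p : ℤ) * Int.negSucc n + μ := by
    rw [Int.negSucc_eq]
    have : (0 : ℤ) ≤ p * n := by positivity
    have : (μ : ℤ) < p := by exact_mod_cast hμ
    rw [mul_neg, mul_add]
    omega
  rw [dworkTerm, dworkCoeff, if_neg h, zero_mul, zero_div]

/-- The system is triangular with diagonal entries `binom(m, m) = 1`. -/
theorem eq_of_sum_choose_nsmul_eq {M : Type*} [AddCommGroup M] {u v : ℕ → M}
    (h : ∀ m, ∑ i ∈ range (m + 1), m.choose i • u i = ∑ i ∈ range (m + 1), m.choose i • v i) :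
    u = v := by
  funext m
  induction m using Nat.strong_induction_on with
  | _ m ih =>
    have hm := h m
    rw [sum_range_succ, sum_range_succ,
      sum_congr rfl fun i hi => by rw [ih i (mem_range.1 hi)]] at hm
    simpa using hm

/-! ### Values of the gamma function at negative integers -/

theorem natCast_dvd_neg_natCast_iff (n : ℕ) : (p : ℤ_[p]) ∣ -(n : ℤ_[p]) ↔ p ∣ n := by
  have := PadicInt.pow_p_dvd_int_iff (p := p) 1 (n : ℤ)
  simpa [Int.natCast_dvd_natCast] using this

/-- Passing from `n` to `n + 1`, the functional equation at `-(n + 1)` leaves `Γ(-n) n!` unchanged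
unless `p ∣ n + 1`, when it gains the factor `-(n + 1) = -p · ((n + 1) / p)`. -/
theorem IsMoritaGamma.neg_natCast_mul_factorial {Γ : ℤ_[p] → ℤ_[p]ˣ} (h : IsMoritaGamma p Γ)
    (n : ℕ) :
    (Γ (-(n : ℤ_[p])) : ℤ_[p]) * n.factorial = (-(p : ℤ_[p])) ^ (n / p) * (n / p).factorial := by
  induction n with
  | zero => simp [h.map_zero]
  | succ n ih =>
    set x : ℤ_[p] := -((n + 1 : ℕ) : ℤ_[p]) with hx
    have hx1 : x + 1 = -(n : ℤ_[p]) := by rw [hx]; push_cast; ring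
    have e : (Γ (x + 1) : ℤ_[p]) = Γ x * ((Γ (x + 1) / Γ x : ℤ_[p]ˣ) : ℤ_[p]) := by
      rw [← Units.val_mul, mul_div_cancel]
    rw [← hx1] at ih
    rw [Nat.factorial_succ, Nat.cast_mul, Nat.succ_div]
    by_cases hn : p ∣ n + 1
    · rw [h.map_add_one_of_dvd x ((natCast_dvd_neg_natCast_iff _).2 hn)] at e
      have hq : ((n + 1 : ℕ) : ℤ_[p]) = p * (n / p + 1 : ℕ) := by
        have h1 : (n + 1) / p = n / p + 1 := by rw [Nat.succ_div, if_pos hn]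
        rw [← h1, ← Nat.cast_mul, Nat.mul_div_cancel' hn]
      rw [if_pos hn, Nat.factorial_succ, pow_succ, Nat.cast_mul (n / p + 1), hq]
      rw [e] at ih
      linear_combination (-(p : ℤ_[p]) * (n / p + 1 : ℕ)) * ih
    · rw [h.map_add_one_of_not_dvd x (fun hd => hn ((natCast_dvd_neg_natCast_iff _).1 hd))] at e
      rw [if_neg hn, add_zero, ← ih, e, hx]
      ring

/-! ### Mahler expansion -/

/-- The function `x ↦ Γ_p(-(p x + μ))` on `ℤ_p`. -/
noncomputable def negGamma (p : ℕ) [Fact p.Prime] (μ : ℕ) : C(ℤ_[p], ℤ_[p]) where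
  toFun x := moritaGamma p (-(p * x + μ))
  continuous_toFun := Units.continuous_val.comp
    ((isMoritaGamma_moritaGamma p).continuous.comp (by fun_prop))

theorem negGamma_apply (μ : ℕ) (x : ℤ_[p]) :
    negGamma p μ x = moritaGamma p (-(p * x + μ)) := rfl

theorem negGamma_natCast_mul_factorial {μ : ℕ} (hμ : μ < p) (m : ℕ) :
    negGamma p μ m * (p * m + μ).factorial = (-(p : ℤ_[p])) ^ m * m.factorial := by
  have h := (isMoritaGamma_moritaGamma p).neg_natCast_mul_factorial (p * m + μ)
  have hq : (p * m + μ) / p = m := by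
    rw [Nat.mul_add_div hp.out.pos, Nat.div_eq_of_lt hμ, add_zero]
  rw [hq] at h
  rw [negGamma_apply, ← h]
  push_cast
  rfl

/-- The inclusion of `ℤ_p` into the algebraic closure of `ℚ_p`. -/
noncomputable def padicIntToAlgCl (p : ℕ) [Fact p.Prime] : ℤ_[p] →+* PadicAlgCl p :=
  (algebraMap ℚ_[p] (PadicAlgCl p)).comp PadicInt.Coe.ringHom

theorem padicIntToAlgCl_apply (x : ℤ_[p]) :
    padicIntToAlgCl p x = algebraMap ℚ_[p] (PadicAlgCl p) x := rfl

theorem continuous_padicIntToAlgCl : Continuous (padicIntToAlgCl p) :=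
  (continuous_algebraMap ℚ_[p] (PadicAlgCl p)).comp continuous_subtype_val

theorem ne_zero_of_pow_eq_neg_prime {π : PadicAlgCl p} (hπ : π ^ (p - 1) = -(p : PadicAlgCl p)) :
    π ≠ 0 := by
  rintro rfl
  have h1 : p - 1 ≠ 0 := by have := hp.out.two_le; omega
  rw [zero_pow h1, eq_comm, neg_eq_zero, Nat.cast_eq_zero] at hπ
  exact hp.out.ne_zero hπ

theorem pow_mul_fwdDiff_negGamma {π : PadicAlgCl p} (hπ : π ^ (p - 1) = -(p : PadicAlgCl p))
    {μ : ℕ} (hμ : μ < p) (i : ℕ) :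
    π ^ μ * padicIntToAlgCl p ((fwdDiff 1)^[i] (negGamma p μ) 0) =
      coeff (p * i + μ) (dworkExp p π) * i.factorial / π ^ i := by
  have hπ0 := ne_zero_of_pow_eq_neg_prime hπ
  refine congrFun (eq_of_sum_choose_nsmul_eq
    (u := fun i => π ^ μ * padicIntToAlgCl p ((fwdDiff 1)^[i] (negGamma p μ) 0))
    (v := fun i => coeff (p * i + μ) (dworkExp p π) * i.factorial / π ^ i) fun m => ?_) i
  have hl : ∑ i ∈ range (m + 1),
      m.choose i • (π ^ μ * padicIntToAlgCl p ((fwdDiff 1)^[i] (negGamma p μ) 0)) =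
      π ^ μ * padicIntToAlgCl p (negGamma p μ m) := by
    have := shift_eq_sum_fwdDiff_iter (1 : ℤ_[p]) (negGamma p μ) m 0
    rw [zero_add, nsmul_one] at this
    rw [this, map_sum, mul_sum]
    exact sum_congr rfl fun i _ => by rw [map_nsmul, mul_smul_comm]
  have hr : ∑ i ∈ range (m + 1),
      m.choose i • (coeff (p * i + μ) (dworkExp p π) * i.factorial / π ^ i) =
      m.factorial / π ^ m * (π ^ (p * m + μ) / (p * m + μ).factorial) := by
    rw [← sum_coeff_dworkExp π m hμ, mul_sum]
    refine sum_congr rfl fun i hi => ?_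
    have hi' : i ≤ m := Nat.lt_succ_iff.1 (mem_range.1 hi)
    have hf : ((m - i).factorial : PadicAlgCl p) ≠ 0 := Nat.cast_ne_zero.2 (Nat.factorial_ne_zero _)
    have hm : π ^ m = π ^ (m - i) * π ^ i := by rw [← pow_add, Nat.sub_add_cancel hi']
    rw [nsmul_eq_mul, ← Nat.choose_mul_factorial_mul_factorial hi', hm]
    push_cast
    field_simp
  have hg := congrArg (padicIntToAlgCl p) (negGamma_natCast_mul_factorial hμ m)
  simp only [map_mul, map_natCast, map_pow, map_neg] at hg
  have hf : ((p * m + μ).factorial : PadicAlgCl p) ≠ 0 :=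
    Nat.cast_ne_zero.2 (Nat.factorial_ne_zero _)
  -- The only use of `π^{p-1} = -p` beyond `π ≠ 0`.
  have hpm : π ^ (p * m + μ) = π ^ μ * π ^ m * (-(p : PadicAlgCl p)) ^ m := by
    rw [← hπ, ← pow_mul, ← pow_add, ← pow_add]
    congr 1
    obtain ⟨q, hq⟩ : ∃ q, p = q + 1 := ⟨p - 1, (Nat.succ_pred_prime hp.out).symm⟩
    rw [hq, Nat.add_sub_cancel]
    ring
  rw [hl, hr, hpm]
  field_simp
  linear_combination hg

/-- Reflection of binomial coefficients, with `i!` cleared because it need not be invertible in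
`ℤ_p`. -/
theorem factorial_mul_mahler_neg (i : ℕ) (x : ℤ_[p]) :
    (i.factorial : ℤ_[p]) * mahler i (-x) = (-1) ^ i * ∏ j ∈ range i, (x + j) := by
  rw [mahler_apply, ← nsmul_eq_mul, ← Ring.descPochhammer_eq_factorial_smul_choose,
    ← Polynomial.aeval_eq_smeval, Polynomial.aeval_def, ← Polynomial.eval_map,
    descPochhammer_map, descPochhammer_eval_eq_prod_range]
  have h : ∀ j ∈ range i, -x - (j : ℤ_[p]) = -1 * (x + j) := fun j _ => by ring
  rw [prod_congr rfl h, prod_mul_distrib, prod_const, card_range]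

theorem hasSum_dworkTerm {π : PadicAlgCl p} (hπ : π ^ (p - 1) = -(p : PadicAlgCl p))
    {μ : ℕ} (hμ : μ < p) {b : ℚ} (x : ℤ_[p]) (hx : (x : ℚ_[p]) = b) :
    HasSum (fun i : ℤ => dworkTerm p π μ b i)
      (π ^ μ * padicIntToAlgCl p (negGamma p μ (-x))) := by
  have hπ0 := ne_zero_of_pow_eq_neg_prime hπ
  have hxb : padicIntToAlgCl p x = b := by
    rw [padicIntToAlgCl_apply, hx, map_ratCast]
  have h1 := ((PadicInt.hasSum_mahler (negGamma p μ)).map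
    (ContinuousMap.evalCLM ℤ_[p] (-x)) (ContinuousMap.evalCLM ℤ_[p] (-x)).continuous)
  -- The sum is taken in `ℤ_p` and carried over by continuity, so completeness of `PadicAlgCl p` is
  -- not required.
  have h2 := (h1.map (padicIntToAlgCl p) continuous_padicIntToAlgCl).mul_left (π ^ μ)
  refine (Function.Injective.hasSum_iff Nat.cast_injective ?_).1 (h2.congr_fun ?_)
  · rintro (n | n) hn
    · exact (hn ⟨n, rfl⟩).elim
    · exact dworkTerm_negSucc π hμ b n
  · intro i
    have hf : (i.factorial : PadicAlgCl p) ≠ 0 := Nat.cast_ne_zero.2 (Nat.factorial_ne_zero _)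
    have h3 := congrArg (padicIntToAlgCl p) (factorial_mul_mahler_neg i x)
    simp only [map_mul, map_natCast, map_pow, map_neg, map_one, map_prod, map_add, hxb] at h3
    have h4 := pow_mul_fwdDiff_negGamma hπ hμ i
    have h5 : dworkTerm p π μ b (i : ℤ) =
        coeff (p * i + μ) (dworkExp p π) * (∏ j ∈ range i, ((b : PadicAlgCl p) + j)) /
          (-π) ^ i := by
      have : ((p : ℤ) * (i : ℤ) + μ) = ((p * i + μ : ℕ) : ℤ) := by push_cast; rfl
      rw [dworkTerm, this, dworkCoeff_natCast, zpow_natCast]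
      rfl
    have h6 : ((-1 : PadicAlgCl p) ^ i) * (-1) ^ i = 1 := by rw [← mul_pow]; simp
    simp only [Function.comp_apply, ContinuousMap.evalCLM_apply, PadicInt.mahlerTerm_apply,
      smul_eq_mul, map_mul]
    rw [h5, mul_left_comm, h4, neg_pow, div_eq_iff (mul_ne_zero (pow_ne_zero _ (by simp))
      (pow_ne_zero _ hπ0))]
    field_simp
    linear_combination (-(-1) ^ i * coeff (p * i + μ) (dworkExp p π)) * h3 -
      (coeff (p * i + μ) (dworkExp p π) * ∏ j ∈ range i, ((b : PadicAlgCl p) + j)) * h6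

end DworkGamma

theorem mainTheorem4 (p : ℕ) [Fact p.Prime] (π : PadicAlgCl p)
    (hπ : π ^ (p - 1) = -(p : PadicAlgCl p))
    (a b : ℚ) (ha : ¬ p ∣ a.den) (hb : ¬ p ∣ b.den)
    (μ : ℕ) (hμ : μ < p) (hab : (p : ℚ) * b - a = μ) :
    Summable (fun i : ℤ => DworkGamma.dworkTerm p π μ b i) ∧
      DworkGamma.dworkGamma p π a b =
        π ^ μ * algebraMap ℚ_[p] (PadicAlgCl p)
          ((DworkGamma.moritaGamma p ⟨(a : ℚ_[p]), Padic.norm_rat_le_one ha⟩ : ℤ_[p]) : ℚ_[p]) := by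
  obtain ⟨x, hx⟩ : ∃ x : ℤ_[p], (x : ℚ_[p]) = b := ⟨⟨b, Padic.norm_rat_le_one hb⟩, rfl⟩
  have h := DworkGamma.hasSum_dworkTerm hπ hμ x hx
  refine ⟨h.summable, ?_⟩
  have hfloor : ⌊(p : ℚ) * b - a⌋ = (μ : ℤ) := by rw [hab, Int.floor_natCast]
  rw [DworkGamma.dworkGamma, hfloor, h.tsum_eq, DworkGamma.negGamma_apply,
    DworkGamma.padicIntToAlgCl_apply]
  -- What remains is the equality of the arguments of `Γ_p`: `-(p (-b) + μ) = a`.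
  congr 5
  apply Subtype.ext
  have hab' : (a : ℚ_[p]) = p * b - μ := by
    have : a = p * b - μ := by rw [← hab]; ring
    rw [this]
    push_cast
    rfl
  push_cast
  rw [hab', ← hx]
  ring
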